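/- **Generalized optimal decision tree.** An instance consists of $m$ hypotheses, $n$ tests $U$ with costs $c_e>0$, for every hypothesis $i\in[m]$ the set $S_i\subseteq U$ of tests that are positive on $i$, probabilities $p_i\ge 0$ with $\sum_i p_i=1$ ($p_i$ is the probability that the true hypothesis $i^*$ is $i$), and a threshold $t_i\in\mathbb N$, $t_i<m$, for every $i$ (the thresholds may differ). For $A\subseteq U$ let $\mathrm{Cand}_i(A)=\{j\in[m]: S_j\cap A=S_i\cap A\}$ be the hypotheses that remain possible after the tests in $A$ if $i^*=i$. Hypothesis $i$ is *satisfied* by $A$ if $|\mathrm{Cand}_i(A)|\le t_i$; assume that performing all tests satisfies every hypothesis. A solution is a binary decision tree with inner nodes labeled by tests; hypothesis $i$ follows the yes-branch at a node labeled $e$ if $e\in S_i$ and the no-branch otherwise. The tree is *feasible* if every $i$ is satisfied by the tests on its path; the cost of $i$ is the total cost of the shortest prefix of its path that satisfies $i$, and the expected cost of the tree is the average of these costs with weights $p_i$. Let $T_e(i)=\{j\in[m]: e\in S_i\oplus S_j\}$ and $$f_i(A)=\min\Big\{\frac{|\bigcup_{e\in A}T_e(i)|}{m-t_i},\,1\Big\}\qquad(A\subseteq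 U,\ i\in[m]).$$ The *greedy algorithm* keeps the set $E$ of tests performed so far and the set $H\subseteq[m]$ of hypotheses $i$ that are compatible with their outcomes and have $f_i(E)\ne 1$. While $H\neq\emptyset$, it performs a test $e\in U\setminus E$ that maximizes $$\frac1{c_e}\Big(\sum_{j\in L_e(H)}p_j+\sum_{i\in H}p_i\,\frac{f_i(E\cup\{e\})-f_i(E)}{1-f_i(E)}\Big),$$ where $L_e(H)$ is the one of $\{i\in H:e\in S_i\}$, $\{i\in H:e\notin S_i\}$ of smaller cardinality (all ties are broken arbitrarily). Then the following hold. 1. Every $f_i$ is monotone and submodular with values in $[0,1]$, $f_i(\emptyset)=0$ and $f_i(U)=1$; and $f_i(A)=1$ if and only if $|\mathrm{Cand}_i(A)|\le t_i$. 2. The greedy algorithm is an $O(\log m)$-approximation algorithm: there is an absolute constant $C$ such that every decision tree it produces is feasible and has expected cost at most $C\log m$ times the expected cost of any feasible decision tree. It runs in polynomial time: an explicit implementation that computes the whole decision tree takes a number of elementary steps (arithmetic operations, comparisons, reading input entries, list and tree constructors, each at unit cost) that is bounded by a fixed polynomial in $m+n$. -/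

import Mathlib

/-- An instance of the generalized optimal decision tree problem with `m` hypotheses and `n` tests.
`pos i` is the set of tests that are positive for hypothesis `i`; `cost e` is the cost of test `e`;
`prob` is the a priori distribution of the true hypothesis; `thr i` is the threshold of
hypothesis `i`. The last two fields say that no requirement is met before the first test and that
every requirement is met once all tests are performed (in particular `1 ≤ thr i`). -/
structure GeneralizedODT (m n : ℕ) where
  cost : Fin n → ℝ
  prob : Fin m → ℝ
  pos : Fin m → Finset (Fin n)
  thr : Fin m → ℕ
  cost_pos : ∀ e, 0 < cost e
  prob_nonneg : ∀ i, 0 ≤ prob i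
  prob_sum : ∑ i, prob i = 1
  thr_lt : ∀ i, thr i < m
  coverable : ∀ i, (Finset.univ.filter (fun j => ∀ e, (e ∈ pos i ↔ e ∈ pos j))).card ≤ thr i

/-- Adaptive solutions: binary trees whose inner nodes are labeled by tests; the first subtree is
the one entered when the test is positive. -/
inductive DecisionTree (n : ℕ) : Type
  | leaf : DecisionTree n
  | node (e : Fin n) (yes no : DecisionTree n) : DecisionTree n

/-- The tests met on the way to a leaf by a hypothesis with set of positive tests `P`. -/
def DecisionTree.path {n : ℕ} (P : Finset (Fin n)) : DecisionTree n → List (Fin n)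
  | .leaf => []
  | .node e yes no => e :: (if e ∈ P then yes.path P else no.path P)

namespace GeneralizedODT

/-! ### The problem -/

/-- The hypotheses that are still possible after the tests in `A`, if `i` is the true one. -/
def candidates {m n : ℕ} (I : GeneralizedODT m n) (i : Fin m) (A : Finset (Fin n)) :
    Finset (Fin m) :=
  Finset.univ.filter (fun j => ∀ e ∈ A, (e ∈ I.pos i ↔ e ∈ I.pos j))

/-- Hypothesis `i` is satisfied by the tests in `A`: at most `thr i` candidates remain. -/
def Satisfied {m n : ℕ} (I : GeneralizedODT m n) (i : Fin m) (A : Finset (Fin n)) : Prop :=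
  (I.candidates i A).card ≤ I.thr i

/-- A decision tree is feasible if every hypothesis is satisfied by the tests on its path. -/
def Feasible {m n : ℕ} (I : GeneralizedODT m n) (T : DecisionTree n) : Prop :=
  ∀ i, I.Satisfied i (T.path (I.pos i)).toFinset

open Classical in
/-- The cost of the tests in the list that are performed, after those in `A`, until
hypothesis `i` is satisfied. -/
noncomputable def costUntil {m n : ℕ} (I : GeneralizedODT m n) (i : Fin m) :
    Finset (Fin n) → List (Fin n) → ℝ
  | _, [] => 0
  | A, e :: l => if I.Satisfied i A then 0 else I.cost e + I.costUntil i (insert e A) l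

/-- The expected cost of a feasible decision tree: hypothesis `i` pays for the shortest prefix of
its path that satisfies it. -/
noncomputable def expectedCost {m n : ℕ} (I : GeneralizedODT m n) (T : DecisionTree n) : ℝ :=
  ∑ i, I.prob i * I.costUntil i ∅ (T.path (I.pos i))

/-! ### The functions `f i` and the greedy algorithm -/

/-- The hypotheses that test `e` tells apart from `i`. -/
def apart {m n : ℕ} (I : GeneralizedODT m n) (e : Fin n) (i : Fin m) : Finset (Fin m) :=
  Finset.univ.filter (fun j => e ∈ symmDiff (I.pos i) (I.pos j))

/-- The truncated coverage function of hypothesis `i`. -/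
noncomputable def f {m n : ℕ} (I : GeneralizedODT m n) (i : Fin m) (A : Finset (Fin n)) : ℝ :=
  min (((A.biUnion (fun e => I.apart e i)).card : ℝ) * (1 / ((m : ℝ) - (I.thr i : ℝ)))) 1

/-- `L` is the part of `H` of smaller cardinality among those on which test `e` is positive,
respectively negative; either part qualifies when they have equal size. -/
def IsMinority {m n : ℕ} (I : GeneralizedODT m n) (H : Finset (Fin m)) (e : Fin n)
    (L : Finset (Fin m)) : Prop :=
  (L = H.filter (fun i => e ∈ I.pos i) ∧
    (H.filter (fun i => e ∈ I.pos i)).card ≤ (H.filter (fun i => e ∉ I.pos i)).card) ∨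
  (L = H.filter (fun i => e ∉ I.pos i) ∧
    (H.filter (fun i => e ∉ I.pos i)).card ≤ (H.filter (fun i => e ∈ I.pos i)).card)

/-- The score of test `e` at the state `(E, H)`, where `L` is a minority part of `H` for `e`. -/
noncomputable def score {m n : ℕ} (I : GeneralizedODT m n) (E : Finset (Fin n))
    (H : Finset (Fin m)) (L : Finset (Fin m)) (e : Fin n) : ℝ :=
  1 / I.cost e * (∑ j ∈ L, I.prob j +
    ∑ i ∈ H, I.prob i * ((I.f i (insert e E) - I.f i E) / (1 - I.f i E)))

open Classical in
/-- The tree is one that the greedy algorithm may produce from the state `(E, H)`, where `E` is the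
set of tests performed so far and `H` is the set of hypotheses that are compatible with their
outcomes and not yet covered. The algorithm stops when `H` is empty; otherwise it performs a new
test of maximum score. Ties, also those between the two parts of `H`, are broken arbitrarily. -/
def IsGreedyFrom {m n : ℕ} (I : GeneralizedODT m n) :
    DecisionTree n → Finset (Fin n) → Finset (Fin m) → Prop
  | .leaf, _, H => H = ∅
  | .node e yes no, E, H =>
      H.Nonempty ∧ e ∉ E ∧
      (∃ L : Fin n → Finset (Fin m), (∀ e', I.IsMinority H e' (L e')) ∧
        ∀ e' ∉ E, I.score E H (L e') e' ≤ I.score E H (L e) e) ∧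
      I.IsGreedyFrom yes (insert e E)
        (H.filter (fun i => e ∈ I.pos i ∧ I.f i (insert e E) ≠ 1)) ∧
      I.IsGreedyFrom no (insert e E)
        (H.filter (fun i => e ∉ I.pos i ∧ I.f i (insert e E) ≠ 1))

open Classical in
/-- The tree is a possible result of the greedy algorithm. -/
def IsGreedy {m n : ℕ} (I : GeneralizedODT m n) (T : DecisionTree n) : Prop :=
  I.IsGreedyFrom T ∅ (Finset.univ.filter (fun i => I.f i ∅ ≠ 1))

end GeneralizedODT

/-! ### An implementation with a step count

Unit-cost model: reading one number or one test outcome of the input, one arithmetic operation or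
comparison, one Boolean operation, one list or tree constructor cost one step each. -/

/-- A value together with the number of steps spent on computing it. -/
structure Timed (α : Type) where
  val : α
  steps : ℕ

namespace Timed

instance : Monad Timed where
  pure a := ⟨a, 0⟩
  bind x g := ⟨(g x.val).val, x.steps + (g x.val).steps⟩

/-- One elementary operation, with result `a`. -/
def op {α : Type} (a : α) : Timed α := ⟨a, 1⟩

/-- A loop over a list; every round costs one step more than its body. -/
def loop {α β : Type} (body : β → α → Timed β) : β → List α → Timed β
  | b, [] => op b
  | b, a :: l => do
      let b' ← body b a
      let b'' ← op b'
      loop body b'' l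

def count {α : Type} (q : α → Timed Bool) (l : List α) : Timed ℕ :=
  loop (fun k a => do
    let b ← q a
    if b then op (k + 1) else op k) 0 l

def filter {α : Type} (q : α → Timed Bool) (l : List α) : Timed (List α) :=
  loop (fun r a => do
    let b ← q a
    if b then op (a :: r) else op r) [] l

noncomputable def sum {α : Type} (g : α → Timed ℝ) (l : List α) : Timed ℝ :=
  loop (fun s a => do
    let x ← g a
    op (s + x)) 0 l

end Timed

namespace GeneralizedODT

/-- Does some test in the list tell `i` and `j` apart? -/
def apartT {m n : ℕ} (I : GeneralizedODT m n) (i j : Fin m) (E : List (Fin n)) : Timed Bool :=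
  Timed.loop (fun r e => do
    let a ← Timed.op (decide (e ∈ I.pos i))
    let b ← Timed.op (decide (e ∈ I.pos j))
    let d ← Timed.op (a != b)
    Timed.op (r || d)) false E

/-- Computes `f i` of the set of tests in the list. -/
noncomputable def fT {m n : ℕ} (I : GeneralizedODT m n) (i : Fin m) (E : List (Fin n)) :
    Timed ℝ := do
  let k ← Timed.count (fun j => I.apartT i j E) (List.finRange m)
  let t ← Timed.op (I.thr i : ℝ)
  let d ← Timed.op ((m : ℝ) - t)
  let x ← Timed.op ((k : ℝ) / d)
  Timed.op (min x 1)

/-- Is `i` not yet covered by the tests in the list? -/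
noncomputable def uncoveredT {m n : ℕ} (I : GeneralizedODT m n) (i : Fin m) (E : List (Fin n)) :
    Timed Bool := do
  let v ← I.fT i E
  Timed.op (decide (v ≠ 1))

/-- Computes the score of test `e` at the state `(E, H)`. -/
noncomputable def scoreT {m n : ℕ} (I : GeneralizedODT m n) (E : List (Fin n))
    (H : List (Fin m)) (e : Fin n) : Timed ℝ := do
  let Y ← Timed.filter (fun i => Timed.op (decide (e ∈ I.pos i))) H
  let N ← Timed.filter (fun i => Timed.op (decide (e ∉ I.pos i))) H
  let y ← Timed.count (fun _ => Timed.op true) Y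
  let z ← Timed.count (fun _ => Timed.op true) N
  let b ← Timed.op (decide (y ≤ z))
  let L ← Timed.op (if b then Y else N)
  let s ← Timed.sum (fun i => Timed.op (I.prob i)) L
  let r ← Timed.sum (fun i => do
    let p ← Timed.op (I.prob i)
    let v ← I.fT i E
    let v' ← I.fT i (e :: E)
    let u ← Timed.op (v' - v)
    let w ← Timed.op (1 - v)
    let q ← Timed.op (u / w)
    Timed.op (p * q)) H
  let g ← Timed.op (s + r)
  let c ← Timed.op (I.cost e)
  Timed.op (g / c)

/-- Finds a test of maximum score in the list `R`, if `R` is not empty. -/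
noncomputable def pickT {m n : ℕ} (I : GeneralizedODT m n) (E : List (Fin n))
    (H : List (Fin m)) (R : List (Fin n)) : Timed (Option (Fin n × ℝ)) :=
  Timed.loop (fun best e => do
    let s ← I.scoreT E H e
    match best with
    | none => Timed.op (some (e, s))
    | some (e', s') => do
        let b ← Timed.op (decide (s' < s))
        if b then Timed.op (some (e, s)) else Timed.op (some (e', s'))) none R

/-- Builds a greedy tree from the state `(E, H)`; `R` lists the tests not in `E`, and the first
argument bounds the depth. -/
noncomputable def buildT {m n : ℕ} (I : GeneralizedODT m n) :
    ℕ → List (Fin n) → List (Fin n) → List (Fin m) → Timed (DecisionTree n)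
  | 0, _, _, _ => Timed.op .leaf
  | k + 1, E, R, H => do
      let done ← Timed.op H.isEmpty
      if done then Timed.op .leaf
      else do
        let best ← I.pickT E H R
        match best with
        | none => Timed.op .leaf
        | some (e, _) => do
            let R' ← Timed.filter (fun e' => Timed.op (decide (e' ≠ e))) R
            let Hyes ← Timed.filter (fun i => do
              let a ← Timed.op (decide (e ∈ I.pos i))
              let u ← I.uncoveredT i (e :: E)
              Timed.op (a && u)) H
            let Hno ← Timed.filter (fun i => do
              let a ← Timed.op (decide (e ∉ I.pos i))
              let u ← I.uncoveredT i (e :: E)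
              Timed.op (a && u)) H
            let E' ← Timed.op (e :: E)
            let yes ← I.buildT k E' R' Hyes
            let no ← I.buildT k E' R' Hno
            Timed.op (.node e yes no)

/-- The greedy algorithm: computes the whole decision tree of the instance. -/
noncomputable def greedyT {m n : ℕ} (I : GeneralizedODT m n) : Timed (DecisionTree n) := do
  let H ← Timed.filter (fun i => I.uncoveredT i []) (List.finRange m)
  I.buildT n [] (List.finRange n) H

end GeneralizedODT

namespace GeneralizedODT

variable {m n : ℕ} (I : GeneralizedODT m n)

/-! ### The truncated coverage functions -/

/-! The approximation proof compares a greedy tree with an arbitrary feasible tree `T'` that runs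
slower by a factor `lam`. Let C_i and O_i be the costs of hypothesis i in the two trees.

Consider a greedy node with surviving set `H`, best score ρ and test cost c, and let t be the cost
spent once the test is done. Follow `T'` along its majority branch, which at each test e is the side
outside the minority part L_e of `H`. A hypothesis that `T'` satisfies within cost s either leaves
this branch in some L_e, or is covered by the tests on it and then counts with full relative
progress. Progress is subadditive and no test scores above ρ, so these hypotheses have probability
at most ρs (`sum_prob_filter_costUntil_le`). With s = t/`lam`, those with `lam`·O_i ≤ t satisfy
`lam`·c·Pr ≤ t·ρc, and ρc is the total weighted gain at the node.

On the path of a single hypothesis the gains sum to at most M = log₂ m + 1 + ln m. Membership in a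
minority part halves `H`, and relative progress telescopes through ln(1 - f)
(`gain_add_potential_le`, `gain_le_potential`). Steps with `lam`·O_i > t have total cost at most
`lam`·O_i. Since t never exceeds C_i, on average `lam`·C ≤ M·C + `lam`²·O, which
`sum_cost_le_of_isGreedyFrom` proves by induction on the greedy tree. Taking `lam` = 2M gives C ≤
4M·O.

The running time is polynomial because the hypothesis lists at equal depth are disjoint, so at most
m·n calls receive a nonempty list within depth n. -/

/-- The hypotheses that some test in `A` tells apart from `i`. -/
def apartFrom (i : Fin m) (A : Finset (Fin n)) : Finset (Fin m) :=
  A.biUnion (fun e => I.apart e i)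

lemma mem_apartFrom {i j : Fin m} {A : Finset (Fin n)} :
    j ∈ I.apartFrom i A ↔ ∃ e ∈ A, ¬ (e ∈ I.pos i ↔ e ∈ I.pos j) := by
  simp only [apartFrom, apart, Finset.mem_biUnion, Finset.mem_filter, Finset.mem_univ, true_and,
    Finset.mem_symmDiff]
  exact exists_congr fun e => and_congr_right fun _ => by tauto

lemma f_def (i : Fin m) (A : Finset (Fin n)) :
    I.f i A = min (((I.apartFrom i A).card : ℝ) * (1 / ((m : ℝ) - (I.thr i : ℝ)))) 1 := rfl

lemma candidates_eq_compl (i : Fin m) (A : Finset (Fin n)) :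
    I.candidates i A = (I.apartFrom i A)ᶜ := by
  ext j
  simp only [candidates, Finset.mem_filter, Finset.mem_univ, true_and, Finset.mem_compl,
    mem_apartFrom]
  push Not
  rfl

lemma card_apartFrom_add (i : Fin m) (A : Finset (Fin n)) :
    (I.apartFrom i A).card + (I.candidates i A).card = m := by
  rw [candidates_eq_compl, Finset.card_add_card_compl, Fintype.card_fin]

lemma gap_pos (i : Fin m) : (0 : ℝ) < (m : ℝ) - (I.thr i : ℝ) := by
  have : (I.thr i : ℝ) < m := by exact_mod_cast I.thr_lt i
  linarith

lemma apartFrom_mono (i : Fin m) {A B : Finset (Fin n)} (h : A ⊆ B) :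
    I.apartFrom i A ⊆ I.apartFrom i B :=
  Finset.biUnion_subset_biUnion_of_subset_left _ h

lemma f_empty (i : Fin m) : I.f i ∅ = 0 := by simp [f]

lemma f_nonneg (i : Fin m) (A : Finset (Fin n)) : 0 ≤ I.f i A := by
  have := I.gap_pos i
  rw [f_def]
  positivity

lemma f_le_one (i : Fin m) (A : Finset (Fin n)) : I.f i A ≤ 1 := min_le_right _ _

lemma f_mono (i : Fin m) {A B : Finset (Fin n)} (h : A ⊆ B) : I.f i A ≤ I.f i B := by
  have := I.gap_pos i
  have hc := Finset.card_le_card (I.apartFrom_mono i h)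
  rw [f_def, f_def]
  gcongr

/-- Truncation at 1 is concave and nondecreasing, hence preserves submodularity of monotone
functions; the four order hypotheses are what monotonicity supplies. -/
lemma min_one_add_min_one_le {w a b u : ℝ} (hwa : w ≤ a) (hwb : w ≤ b) (hau : a ≤ u) (hbu : b ≤ u)
    (h : w + u ≤ a + b) : min w 1 + min u 1 ≤ min a 1 + min b 1 := by
  simp only [min_def]
  split_ifs <;> linarith

lemma f_submodular (i : Fin m) (A B : Finset (Fin n)) :
    I.f i (A ∩ B) + I.f i (A ∪ B) ≤ I.f i A + I.f i B := by
  have hd := I.gap_pos i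
  have mono : ∀ {X Y : Finset (Fin n)}, X ⊆ Y →
      ((I.apartFrom i X).card : ℝ) * (1 / ((m : ℝ) - (I.thr i : ℝ))) ≤
      ((I.apartFrom i Y).card : ℝ) * (1 / ((m : ℝ) - (I.thr i : ℝ))) := by
    intro X Y h
    have hc := Finset.card_le_card (I.apartFrom_mono i h)
    gcongr
  simp only [f_def]
  refine min_one_add_min_one_le (mono Finset.inter_subset_left) (mono Finset.inter_subset_right)
    (mono Finset.subset_union_left) (mono Finset.subset_union_right) ?_
  rw [← add_mul, ← add_mul]
  have hu : I.apartFrom i (A ∪ B) = I.apartFrom i A ∪ I.apartFrom i B :=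
    Finset.union_biUnion
  have hi : I.apartFrom i (A ∩ B) ⊆ I.apartFrom i A ∩ I.apartFrom i B :=
    Finset.subset_inter (I.apartFrom_mono i Finset.inter_subset_left)
      (I.apartFrom_mono i Finset.inter_subset_right)
  have hc : (I.apartFrom i (A ∩ B)).card + (I.apartFrom i (A ∪ B)).card ≤
      (I.apartFrom i A).card + (I.apartFrom i B).card := by
    rw [hu, ← Finset.card_union_add_card_inter (I.apartFrom i A)]
    have := Finset.card_le_card hi
    omega
  have hc' : ((I.apartFrom i (A ∩ B)).card : ℝ) + (I.apartFrom i (A ∪ B)).card ≤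
      (I.apartFrom i A).card + (I.apartFrom i B).card := by exact_mod_cast hc
  gcongr

lemma f_eq_one_iff_card (i : Fin m) (A : Finset (Fin n)) :
    I.f i A = 1 ↔ m ≤ (I.apartFrom i A).card + I.thr i := by
  rw [f_def, min_eq_right_iff, mul_one_div, one_le_div (I.gap_pos i), sub_le_iff_le_add]
  exact_mod_cast Iff.rfl

lemma f_eq_one_iff (i : Fin m) (A : Finset (Fin n)) :
    I.f i A = 1 ↔ (I.candidates i A).card ≤ I.thr i := by
  rw [f_eq_one_iff_card]
  have := I.card_apartFrom_add i A
  omega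

lemma f_eq_one_iff_satisfied (i : Fin m) (A : Finset (Fin n)) :
    I.f i A = 1 ↔ I.Satisfied i A := I.f_eq_one_iff i A

lemma f_univ (i : Fin m) : I.f i Finset.univ = 1 := by
  rw [f_eq_one_iff]
  simpa [candidates] using I.coverable i

lemma f_lt_one {i : Fin m} {A : Finset (Fin n)} (h : I.f i A ≠ 1) : I.f i A < 1 :=
  lt_of_le_of_ne (I.f_le_one i A) h

/-- Coverage is an integer, so an uncovered hypothesis misses at least one unit out of `m - thr i ≤
m`. This keeps the logarithm in `potential` nonnegative. -/
lemma one_le_mul_one_sub_f {i : Fin m} {A : Finset (Fin n)} (h : I.f i A ≠ 1) :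
    1 ≤ (m : ℝ) * (1 - I.f i A) := by
  have hd := I.gap_pos i
  have hc : (I.apartFrom i A).card + I.thr i + 1 ≤ m := by
    have := (I.f_eq_one_iff_card i A).not.mp h
    omega
  have hc' : ((I.apartFrom i A).card : ℝ) + I.thr i + 1 ≤ m := by exact_mod_cast hc
  have hm : (0 : ℝ) < m := by
    have : 0 < m := by omega
    exact_mod_cast this
  have h1 : I.f i A ≤ ((I.apartFrom i A).card : ℝ) * (1 / ((m : ℝ) - (I.thr i : ℝ))) :=
    min_le_left _ _
  rw [mul_one_div] at h1
  have h2 : 1 / ((m : ℝ) - I.thr i) ≤ 1 - I.f i A := by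
    have : ((I.apartFrom i A).card : ℝ) / ((m : ℝ) - I.thr i) + 1 / ((m : ℝ) - I.thr i) ≤ 1 := by
      rw [← add_div, div_le_one hd]
      linarith
    linarith
  have h3 : 1 / (m : ℝ) ≤ 1 / ((m : ℝ) - I.thr i) := by
    apply one_div_le_one_div_of_le hd
    have : (0 : ℝ) ≤ I.thr i := by positivity
    linarith
  calc (1 : ℝ) = m * (1 / m) := by field_simp
    _ ≤ _ := by gcongr; linarith

/-- Diminishing returns: after the tests in `A`, test `e` adds no more than it adds to `E` alone. -/
lemma f_insert_union_le (i : Fin m) (e : Fin n) (E A : Finset (Fin n)) :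
    I.f i (E ∪ insert e A) + I.f i E ≤ I.f i (insert e E) + I.f i (E ∪ A) := by
  have h := I.f_submodular i (insert e E) (E ∪ A)
  have h1 : I.f i E ≤ I.f i (insert e E ∩ (E ∪ A)) :=
    I.f_mono i (Finset.subset_inter (Finset.subset_insert _ _) Finset.subset_union_left)
  have h2 : insert e E ∪ (E ∪ A) = E ∪ insert e A := by
    ext x; simp only [Finset.mem_union, Finset.mem_insert]; tauto
  rw [h2] at h
  linarith

lemma Satisfied.mono {I : GeneralizedODT m n} {i : Fin m} {A B : Finset (Fin n)}
    (h : I.Satisfied i A) (hAB : A ⊆ B) : I.Satisfied i B := by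
  rw [← f_eq_one_iff_satisfied] at h ⊢
  exact le_antisymm (I.f_le_one i B) (h ▸ I.f_mono i hAB)

/-! ### Costs -/

lemma costUntil_of_satisfied {i : Fin m} {A : Finset (Fin n)} (h : I.Satisfied i A)
    (l : List (Fin n)) : I.costUntil i A l = 0 := by
  cases l <;> simp [costUntil, h]

lemma costUntil_cons_of_not_satisfied {i : Fin m} {A : Finset (Fin n)} (h : ¬ I.Satisfied i A)
    (e : Fin n) (l : List (Fin n)) :
    I.costUntil i A (e :: l) = I.cost e + I.costUntil i (insert e A) l := by
  simp [costUntil, h]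

lemma costUntil_nonneg (i : Fin m) (A : Finset (Fin n)) (l : List (Fin n)) :
    0 ≤ I.costUntil i A l := by
  induction l generalizing A with
  | nil => simp [costUntil]
  | cons e l ih =>
    rw [costUntil]
    split_ifs
    · exact le_rfl
    · have := I.cost_pos e
      have := ih (insert e A)
      linarith

/-! ### Minority parts -/

lemma IsMinority.subset {I : GeneralizedODT m n} {H L : Finset (Fin m)} {e : Fin n}
    (h : I.IsMinority H e L) : L ⊆ H := by
  rcases h with ⟨rfl, -⟩ | ⟨rfl, -⟩ <;> exact Finset.filter_subset _ _

lemma IsMinority.two_mul_card_le {I : GeneralizedODT m n} {H L : Finset (Fin m)} {e : Fin n}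
    (h : I.IsMinority H e L) : 2 * L.card ≤ H.card := by
  have := Finset.card_filter_add_card_filter_not (s := H) (fun i => e ∈ I.pos i)
  rcases h with ⟨rfl, h⟩ | ⟨rfl, h⟩ <;> omega

lemma IsMinority.mem_iff {I : GeneralizedODT m n} {H L : Finset (Fin m)} {e : Fin n}
    (h : I.IsMinority H e L) {i j : Fin m} (hi : i ∈ L) (hj : j ∈ H)
    (hij : e ∈ I.pos i ↔ e ∈ I.pos j) : j ∈ L := by
  rcases h with ⟨rfl, -⟩ | ⟨rfl, -⟩ <;> simp_all

lemma IsMinority.mem_pos_iff {I : GeneralizedODT m n} {H L : Finset (Fin m)} {e : Fin n}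
    (h : I.IsMinority H e L) {i j : Fin m} (hi : i ∈ H) (hj : j ∈ H) (hi' : i ∉ L)
    (hj' : j ∉ L) : e ∈ I.pos i ↔ e ∈ I.pos j := by
  rcases h with ⟨rfl, -⟩ | ⟨rfl, -⟩ <;> simp_all

/-- If the test does not split `H`, a nonempty part would be all of `H`, which exceeds half of it.
-/
lemma IsMinority.eq_empty {I : GeneralizedODT m n} {H L : Finset (Fin m)} {e : Fin n}
    (h : I.IsMinority H e L) (hH : ∀ i ∈ H, ∀ j ∈ H, (e ∈ I.pos i ↔ e ∈ I.pos j)) : L = ∅ := by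
  by_contra hne
  obtain ⟨i, hi⟩ := Finset.nonempty_iff_ne_empty.mpr hne
  have hsub : H ⊆ L := fun j hj => h.mem_iff hi hj (hH i (h.subset hi) j hj)
  have h1 := Finset.card_le_card hsub
  have h2 := h.two_mul_card_le
  have h3 := Finset.card_pos.mpr ⟨i, hi⟩
  omega

/-! ### Covering along the majority branch of a decision tree -/

/-- The weighted relative progress made on the hypotheses in `H` by adding the tests in `A` to
those in `E`. -/
noncomputable def progress (E : Finset (Fin n)) (H : Finset (Fin m)) (A : Finset (Fin n)) : ℝ :=
  ∑ i ∈ H, I.prob i * ((I.f i (E ∪ A) - I.f i E) / (1 - I.f i E))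

lemma progress_singleton (E : Finset (Fin n)) (H : Finset (Fin m)) (e : Fin n) :
    I.progress E H {e} =
      ∑ i ∈ H, I.prob i * ((I.f i (insert e E) - I.f i E) / (1 - I.f i E)) := by
  have : E ∪ {e} = insert e E := by rw [Finset.union_comm]; rfl
  simp only [progress, this]

lemma progress_insert_le (E : Finset (Fin n)) (H : Finset (Fin m)) (e : Fin n)
    (A : Finset (Fin n)) :
    I.progress E H (insert e A) ≤ I.progress E H A + I.progress E H {e} := by
  rw [progress_singleton, progress, progress, ← Finset.sum_add_distrib]
  refine Finset.sum_le_sum fun i _ => ?_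
  rw [← mul_add, ← add_div]
  have h1 := I.f_le_one i E
  have h2 := I.f_insert_union_le i e E A
  exact mul_le_mul_of_nonneg_left
    (div_le_div_of_nonneg_right (by linarith) (by linarith)) (I.prob_nonneg i)

lemma sum_prob_le_progress {E : Finset (Fin n)} {H F : Finset (Fin m)} {A : Finset (Fin n)}
    (hH : ∀ i ∈ H, I.f i E ≠ 1) (hF : F ⊆ H) (hA : ∀ i ∈ F, I.Satisfied i A) :
    ∑ i ∈ F, I.prob i ≤ I.progress E H A := by
  calc ∑ i ∈ F, I.prob i
      = ∑ i ∈ F, I.prob i * ((I.f i (E ∪ A) - I.f i E) / (1 - I.f i E)) := by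
        refine Finset.sum_congr rfl fun i hi => ?_
        have h1 : I.f i (E ∪ A) = 1 := by
          rw [f_eq_one_iff_satisfied]
          exact (hA i hi).mono Finset.subset_union_right
        have h2 := I.f_lt_one (hH i (hF hi))
        rw [h1, div_self (by linarith), mul_one]
    _ ≤ _ := by
        refine Finset.sum_le_sum_of_subset_of_nonneg hF fun i hi _ => ?_
        have h2 := I.f_lt_one (hH i hi)
        have h3 := I.f_mono i (Finset.subset_union_left (s₁ := E) (s₂ := A))
        exact mul_nonneg (I.prob_nonneg i) (div_nonneg (by linarith) (by linarith))

-- Induction down the majority branch: `A` collects its tests so far, `F` the hypotheses still on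
-- it, `s` the remaining budget. The minority parts are those of the fixed set `H`, not of the
-- shrinking `F`, so every test on the branch is measured by the same score.
open Classical in
lemma sum_prob_filter_costUntil_le {E : Finset (Fin n)} {H : Finset (Fin m)}
    {L : Fin n → Finset (Fin m)} {ρ : ℝ} (hH : ∀ i ∈ H, I.f i E ≠ 1)
    (hL : ∀ e, I.IsMinority H e (L e)) (hρ0 : 0 ≤ ρ)
    (hρ : ∀ e, ∑ i ∈ L e, I.prob i + I.progress E H {e} ≤ ρ * I.cost e)
    (T : DecisionTree n) {A : Finset (Fin n)} {F : Finset (Fin m)} (hF : F ⊆ H)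
    (hT : ∀ i ∈ F, I.Satisfied i (A ∪ (T.path (I.pos i)).toFinset)) {s : ℝ} (hs : 0 ≤ s) :
    ∑ i ∈ F.filter (fun i => I.costUntil i A (T.path (I.pos i)) ≤ s), I.prob i ≤
      ρ * s + I.progress E H A := by
  induction T generalizing A F s with
  | leaf =>
    have h := I.sum_prob_le_progress (F := F.filter
      (fun i => I.costUntil i A (DecisionTree.leaf.path (I.pos i)) ≤ s)) hH
      ((Finset.filter_subset _ _).trans hF) (A := A) (fun i hi => by
        simpa [DecisionTree.path] using hT i (Finset.mem_filter.mp hi).1)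
    have := mul_nonneg hρ0 hs
    linarith
  | node e yes no ihy ihn =>
    -- The budget does not pay for `e`, so whoever finishes within it is already satisfied by `A`.
    by_cases hc : s < I.cost e
    · have h := I.sum_prob_le_progress (F := F.filter
        (fun i => I.costUntil i A ((DecisionTree.node e yes no).path (I.pos i)) ≤ s)) hH
        ((Finset.filter_subset _ _).trans hF) (A := A) (fun i hi => by
          by_contra hsat
          have h1 := (Finset.mem_filter.mp hi).2
          rw [DecisionTree.path, I.costUntil_cons_of_not_satisfied hsat] at h1
          have h2 := I.costUntil_nonneg i (insert e A)
            (if e ∈ I.pos i then yes.path (I.pos i) else no.path (I.pos i))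
          linarith)
      have := mul_nonneg hρ0 hs
      linarith
    push Not at hc
    -- Here `T'` is the child on the majority side. Test `e` is paid for by `ρ * cost e`, which
    -- covers both the hypotheses lost to `L e` and the extra progress.
    have key : ∀ (T' : DecisionTree n),
        (∀ i ∈ F \ L e, (DecisionTree.node e yes no).path (I.pos i) = e :: T'.path (I.pos i)) →
        (∑ i ∈ (F \ L e).filter (fun i => I.costUntil i (insert e A) (T'.path (I.pos i)) ≤
          s - I.cost e), I.prob i ≤ ρ * (s - I.cost e) + I.progress E H (insert e A)) →
        ∑ i ∈ F.filter (fun i => I.costUntil i A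
          ((DecisionTree.node e yes no).path (I.pos i)) ≤ s), I.prob i ≤
          ρ * s + I.progress E H A := by
      intro T' hT' hle
      have hsub : F.filter (fun i => I.costUntil i A
          ((DecisionTree.node e yes no).path (I.pos i)) ≤ s) ⊆
          L e ∪ (F \ L e).filter (fun i => I.costUntil i (insert e A) (T'.path (I.pos i)) ≤
          s - I.cost e) := by
        intro i hi
        obtain ⟨hiF, hic⟩ := Finset.mem_filter.mp hi
        by_cases hiL : i ∈ L e
        · exact Finset.mem_union_left _ hiL
        refine Finset.mem_union_right _ (Finset.mem_filter.mpr
          ⟨Finset.mem_sdiff.mpr ⟨hiF, hiL⟩, ?_⟩)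
        rw [hT' i (Finset.mem_sdiff.mpr ⟨hiF, hiL⟩)] at hic
        by_cases hsat : I.Satisfied i A
        · rw [I.costUntil_of_satisfied (hsat.mono (Finset.subset_insert _ _))]
          linarith
        · rw [I.costUntil_cons_of_not_satisfied hsat] at hic
          linarith
      have h1 := Finset.sum_le_sum_of_subset_of_nonneg hsub (fun i _ _ => I.prob_nonneg i)
      rw [Finset.sum_union (Finset.disjoint_sdiff.mono_right (Finset.filter_subset _ _))] at h1
      have h2 := I.progress_insert_le E H e A
      have h3 := hρ e
      linarith
    have hsub' : F \ L e ⊆ H := Finset.sdiff_subset.trans hF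
    have hsat : ∀ T' : DecisionTree n, (∀ i ∈ F \ L e,
        (DecisionTree.node e yes no).path (I.pos i) = e :: T'.path (I.pos i)) →
        ∀ i ∈ F \ L e, I.Satisfied i (insert e A ∪ (T'.path (I.pos i)).toFinset) := by
      intro T' hT' i hi
      have h := hT i (Finset.sdiff_subset hi)
      rw [hT' i hi, List.toFinset_cons] at h
      simpa using h
    -- All of `F \ L e` has one outcome; if it is empty, the yes-branch serves vacuously.
    by_cases hyes : ∀ i ∈ F \ L e, e ∈ I.pos i
    · have hp : ∀ i ∈ F \ L e,
          (DecisionTree.node e yes no).path (I.pos i) = e :: yes.path (I.pos i) := by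
        intro i hi
        simp [DecisionTree.path, hyes i hi]
      exact key yes hp (ihy hsub' (hsat yes hp) (by linarith))
    · push Not at hyes
      obtain ⟨j, hj, hje⟩ := hyes
      have hp : ∀ i ∈ F \ L e,
          (DecisionTree.node e yes no).path (I.pos i) = e :: no.path (I.pos i) := by
        intro i hi
        have : e ∉ I.pos i := by
          rwa [(hL e).mem_pos_iff (hsub' hi) (hsub' hj) (Finset.mem_sdiff.mp hi).2
            (Finset.mem_sdiff.mp hj).2]
        simp [DecisionTree.path, this]
      exact key no hp (ihn hsub' (hsat no hp) (by linarith))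

/-! ### The potential of a hypothesis -/

/-- A bound on the gain that hypothesis `i` can still contribute from the state `(E, H)` on. -/
noncomputable def potential (i : Fin m) (E : Finset (Fin n)) (H : Finset (Fin m)) : ℝ :=
  Real.logb 2 H.card + 1 + Real.log (m * (1 - I.f i E))

open Classical in
/-- The gain that hypothesis `i` contributes to the score of test `e`, times its cost. -/
noncomputable def gain (E : Finset (Fin n)) (L : Finset (Fin m)) (e : Fin n) (i : Fin m) : ℝ :=
  (if i ∈ L then 1 else 0) + (I.f i (insert e E) - I.f i E) / (1 - I.f i E)

lemma sum_gain {E : Finset (Fin n)} {H L : Finset (Fin m)} (hL : L ⊆ H) (e : Fin n) :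
    ∑ i ∈ H, I.prob i * I.gain E L e i = ∑ i ∈ L, I.prob i + I.progress E H {e} := by
  classical
  simp only [gain, mul_add, Finset.sum_add_distrib, progress_singleton, mul_ite, mul_one, mul_zero]
  rw [Finset.sum_ite_mem, Finset.inter_eq_right.mpr hL]

lemma gain_nonneg (E : Finset (Fin n)) (L : Finset (Fin m)) (e : Fin n) (i : Fin m) :
    0 ≤ I.gain E L e i := by
  have h1 := I.f_mono i (Finset.subset_insert e E)
  have h2 := I.f_le_one i E
  have : 0 ≤ (I.f i (insert e E) - I.f i E) / (1 - I.f i E) :=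
    div_nonneg (by linarith) (by linarith)
  unfold gain
  split_ifs <;> linarith

lemma logb_card_add_one_le {a b : ℕ} (ha : 1 ≤ a) (h : 2 * a ≤ b) :
    Real.logb 2 a + 1 ≤ Real.logb 2 b := by
  have ha' : (0 : ℝ) < a := by exact_mod_cast ha
  have h2 : Real.logb 2 a + 1 = Real.logb 2 (2 * a) := by
    rw [Real.logb_mul (by norm_num) ha'.ne', Real.logb_self_eq_one (by norm_num)]
    ring
  rw [h2]
  exact Real.logb_le_logb_of_le (by norm_num) (by positivity) (by exact_mod_cast h)

/-- Used for the test that covers `i`. The summand 1 of the potential pays for the last relative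
progress; if `i` is also in the minority, `H` has at least two elements and its binary logarithm
pays for that. -/
lemma gain_le_potential {E : Finset (Fin n)} {H L : Finset (Fin m)} {e : Fin n} {i : Fin m}
    (hL : I.IsMinority H e L) (hi : i ∈ H) (hf : I.f i E ≠ 1) :
    I.gain E L e i ≤ I.potential i E H := by
  have h1 := I.f_lt_one hf
  have h2 := I.f_le_one i (insert e E)
  have h3 : (I.f i (insert e E) - I.f i E) / (1 - I.f i E) ≤ 1 := by
    rw [div_le_one (by linarith)]
    linarith
  have h4 : 0 ≤ Real.log (m * (1 - I.f i E)) := Real.log_nonneg (I.one_le_mul_one_sub_f hf)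
  unfold gain potential
  split_ifs with hiL
  · have h5 := logb_card_add_one_le (le_refl 1)
      (by have := hL.two_mul_card_le; have := Finset.card_pos.mpr ⟨i, hiL⟩; omega :
        2 * 1 ≤ H.card)
    simp only [Nat.cast_one, Real.logb_one] at h5
    linarith
  · have h5 : 0 ≤ Real.logb 2 H.card :=
      Real.logb_nonneg (by norm_num) (by exact_mod_cast Finset.card_pos.mpr ⟨i, hi⟩)
    linarith

/-- If `i ∈ L`, the survivors `H'` lie in `L`, so the binary logarithm drops by at least 1. For the
ratio r of the new to the old value of `1 - f`, the relative progress is 1 - r ≤ -ln r. -/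
lemma gain_add_potential_le {E : Finset (Fin n)} {H H' L : Finset (Fin m)} {e : Fin n} {i : Fin m}
    (hL : I.IsMinority H e L) (hi : i ∈ H') (hH' : H' ⊆ H)
    (hiff : ∀ j ∈ H', (e ∈ I.pos i ↔ e ∈ I.pos j)) (hf : I.f i E ≠ 1)
    (hf' : I.f i (insert e E) ≠ 1) :
    I.gain E L e i + I.potential i (insert e E) H' ≤ I.potential i E H := by
  have h1 := I.f_lt_one hf
  have h2 := I.f_lt_one hf'
  have hm : (0 : ℝ) < m := by exact_mod_cast i.pos
  have hpos := Finset.card_pos.mpr ⟨i, hi⟩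
  have h3 : (I.f i (insert e E) - I.f i E) / (1 - I.f i E) +
      Real.log (m * (1 - I.f i (insert e E))) ≤ Real.log (m * (1 - I.f i E)) := by
    have h4 := Real.log_le_sub_one_of_pos
      (div_pos (by linarith : 0 < 1 - I.f i (insert e E)) (by linarith : 0 < 1 - I.f i E))
    rw [Real.log_div (by linarith) (by linarith)] at h4
    rw [Real.log_mul hm.ne' (by linarith), Real.log_mul hm.ne' (by linarith)]
    have h5 : (1 - I.f i (insert e E)) / (1 - I.f i E) - 1 =
        - ((I.f i (insert e E) - I.f i E) / (1 - I.f i E)) := by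
      have : 1 - I.f i E ≠ 0 := by linarith
      field_simp
      ring
    linarith
  unfold gain potential
  split_ifs with hiL
  · have hsub : H' ⊆ L := fun j hj => hL.mem_iff hiL (hH' hj) (hiff j hj)
    have h5 := logb_card_add_one_le hpos
      (by have := hL.two_mul_card_le; have := Finset.card_le_card hsub; omega :
        2 * H'.card ≤ H.card)
    linarith
  · have h5 : Real.logb 2 H'.card ≤ Real.logb 2 H.card :=
      Real.logb_le_logb_of_le (by norm_num) (by exact_mod_cast hpos)
        (by exact_mod_cast Finset.card_le_card hH')
    linarith

/-! ### The greedy algorithm against an arbitrary solution -/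

lemma score_mul_cost (E : Finset (Fin n)) (H L : Finset (Fin m)) (e : Fin n) :
    I.score E H L e * I.cost e = ∑ i ∈ L, I.prob i + I.progress E H {e} := by
  have := (I.cost_pos e).ne'
  rw [score, progress_singleton]
  field_simp

lemma progress_singleton_of_mem {E : Finset (Fin n)} (H : Finset (Fin m)) {e : Fin n}
    (he : e ∈ E) : I.progress E H {e} = 0 := by
  simp [progress_singleton, Finset.insert_eq_of_mem he]

/-- The reserve `max (x - τ) 0` pays for every step that ends before time `x`. -/
lemma max_sub_step (x τ c : ℝ) :
    (if x ≤ τ + c then 0 else c) + max (x - (τ + c)) 0 ≤ max (x - τ) 0 := by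
  split_ifs with h
  · rw [max_eq_right (by linarith)]
    simp
  · rw [max_eq_left (by linarith)]
    exact le_max_of_le_left (by linarith)

/-- One hypothesis at one node: the node's term plus the child's term, whose clock reads `τ + c`,
dominate the parent's term. The surplus `C * g` is dropped: the gain is weighted by the current time
rather than the final cost. -/
lemma step_bound_of_survive {lam c τ O C g Φ Φ' : ℝ} (hlam : 0 < lam) (hc : 0 ≤ c)
    (hC : 0 ≤ C) (hg : 0 ≤ g) (hΦ : g + Φ' ≤ Φ)
    (hτ : 0 ≤ τ) :
    lam * (c + C) - (τ + (c + C)) * Φ - lam * max (lam * O - τ) 0 ≤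
      (lam * c * (if lam * O ≤ τ + c then 1 else 0) - (τ + c) * g) +
      (lam * C - (τ + c + C) * Φ' - lam * max (lam * O - (τ + c)) 0) := by
  have h1 := mul_le_mul_of_nonneg_left (max_sub_step (lam * O) τ c) hlam.le
  have h2 := mul_le_mul_of_nonneg_left hΦ (by linarith : 0 ≤ τ + (c + C))
  have h3 := mul_nonneg hC hg
  split_ifs at h1 ⊢ <;> nlinarith

/-- No child term remains, so `g ≤ Φ` suffices. Truncating both at 0 makes the previous lemma
applicable without sign assumptions. -/
lemma step_bound_of_covered {lam c τ O g Φ : ℝ} (hlam : 0 < lam) (hc : 0 ≤ c) (hΦ : g ≤ Φ)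
    (hτ : 0 ≤ τ) :
    lam * c - (τ + c) * Φ - lam * max (lam * O - τ) 0 ≤
      lam * c * (if lam * O ≤ τ + c then 1 else 0) - (τ + c) * g := by
  have h := step_bound_of_survive (O := O) (Φ' := 0) (C := 0) hlam hc le_rfl
    (le_max_right g 0) (Φ := max Φ 0) (by simpa using max_le_max hΦ le_rfl) hτ
  have h1 := mul_le_mul_of_nonneg_left (max_sub_step (lam * O) τ c) hlam.le
  have h2 := mul_le_mul_of_nonneg_left hΦ (by linarith : 0 ≤ τ + c)
  have h3 : 0 ≤ lam * max (lam * O - (τ + c)) 0 := mul_nonneg hlam.le (le_max_right _ _)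
  split_ifs at h1 ⊢ <;> nlinarith

/-- `τ` is the cost already spent on reaching the state. The reserve for `T'` is reduced by `τ`
because earlier steps have used that part of it. -/
theorem sum_cost_le_of_isGreedyFrom {lam : ℝ} (hlam : 0 < lam) {T' : DecisionTree n}
    (hT' : I.Feasible T') (T : DecisionTree n) {E : Finset (Fin n)} {H : Finset (Fin m)} {τ : ℝ}
    (hτ : 0 ≤ τ) (hT : I.IsGreedyFrom T E H)
    (hE : ∀ e ∈ E, ∀ i ∈ H, ∀ j ∈ H, (e ∈ I.pos i ↔ e ∈ I.pos j))
    (hH : ∀ i ∈ H, I.f i E ≠ 1) :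
    ∑ i ∈ H, I.prob i * (lam * I.costUntil i E (T.path (I.pos i)) -
      (τ + I.costUntil i E (T.path (I.pos i))) * I.potential i E H -
      lam * max (lam * I.costUntil i ∅ (T'.path (I.pos i)) - τ) 0) ≤ 0 := by
  classical
  induction T generalizing E H τ with
  | leaf => simp [show H = ∅ from hT]
  | node e yes no ihy ihn =>
    obtain ⟨-, heE, ⟨L, hL, hmax⟩, hy, hn⟩ := hT
    have hc := I.cost_pos e
    have hsub : ∀ P : Fin m → Prop, H.filter (fun i => P i ∧ I.f i (insert e E) ≠ 1) ⊆ H :=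
      fun P => Finset.filter_subset _ _
    have IHy := ihy (by linarith : 0 ≤ τ + I.cost e) hy
      (by
        intro e' he' i hi j hj
        rcases Finset.mem_insert.mp he' with rfl | he'
        · simp [(Finset.mem_filter.mp hi).2.1, (Finset.mem_filter.mp hj).2.1]
        · exact hE e' he' i (Finset.filter_subset _ _ hi) j (Finset.filter_subset _ _ hj))
      (fun i hi => (Finset.mem_filter.mp hi).2.2)
    have IHn := ihn (by linarith : 0 ≤ τ + I.cost e) hn
      (by
        intro e' he' i hi j hj
        rcases Finset.mem_insert.mp he' with rfl | he'
        · simp [(Finset.mem_filter.mp hi).2.1, (Finset.mem_filter.mp hj).2.1]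
        · exact hE e' he' i (Finset.filter_subset _ _ hi) j (Finset.filter_subset _ _ hj))
      (fun i hi => (Finset.mem_filter.mp hi).2.2)
    set ρ := I.score E H (L e) e with hρdef
    have hgain : ∑ i ∈ H, I.prob i * I.gain E (L e) e i = ρ * I.cost e := by
      rw [I.sum_gain (hL e).subset, hρdef, score_mul_cost]
    have hρ0 : 0 ≤ ρ := by
      have : 0 ≤ ρ * I.cost e := hgain ▸ Finset.sum_nonneg fun i _ =>
        mul_nonneg (I.prob_nonneg i) (I.gain_nonneg _ _ _ _)
      exact nonneg_of_mul_nonneg_left this hc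
    -- Greedy compares only new tests, but `T'` may use old ones. An old test does not split `H` and
    -- makes no progress, so its left side is 0.
    have hρ : ∀ e', ∑ i ∈ L e', I.prob i + I.progress E H {e'} ≤ ρ * I.cost e' := by
      intro e'
      by_cases he' : e' ∈ E
      · rw [(hL e').eq_empty (hE e' he'), I.progress_singleton_of_mem H he']
        simpa using mul_nonneg hρ0 (I.cost_pos e').le
      · rw [← score_mul_cost]
        exact mul_le_mul_of_nonneg_right (hmax e' he') (I.cost_pos e').le
    have hstem := I.sum_prob_filter_costUntil_le hH hL hρ0 hρ T' (A := ∅) (F := H)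
      Finset.Subset.rfl (fun i _ => by simpa using hT' i)
      (div_nonneg (by linarith) hlam.le : 0 ≤ (τ + I.cost e) / lam)
    have hprog : I.progress E H ∅ = 0 := by simp [progress]
    rw [hprog, add_zero, Finset.sum_filter] at hstem
    -- This is `hstem` multiplied by `lam * cost e`, with `ρ * cost e` rewritten as the total gain.
    have hnode : ∑ i ∈ H, I.prob i * (lam * I.cost e *
        (if lam * I.costUntil i ∅ (T'.path (I.pos i)) ≤ τ + I.cost e then 1 else 0) -
        (τ + I.cost e) * I.gain E (L e) e i) ≤ 0 := by
      have h1 : ∑ i ∈ H, I.prob i * (lam * I.cost e *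
          (if lam * I.costUntil i ∅ (T'.path (I.pos i)) ≤ τ + I.cost e then 1 else 0) -
          (τ + I.cost e) * I.gain E (L e) e i) =
          lam * I.cost e * (∑ i ∈ H, if I.costUntil i ∅ (T'.path (I.pos i)) ≤
            (τ + I.cost e) / lam then I.prob i else 0) -
          (τ + I.cost e) * ∑ i ∈ H, I.prob i * I.gain E (L e) e i := by
        rw [Finset.mul_sum, Finset.mul_sum, ← Finset.sum_sub_distrib]
        refine Finset.sum_congr rfl fun i _ => ?_
        simp only [le_div_iff₀' hlam]
        split_ifs <;> ring
      have h2 := mul_le_mul_of_nonneg_left hstem (mul_nonneg hlam.le hc.le)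
      have h3 : lam * I.cost e * (ρ * ((τ + I.cost e) / lam)) =
          (τ + I.cost e) * (ρ * I.cost e) := by field_simp
      rw [h1, hgain]
      linarith
    rw [Finset.sum_filter] at IHy IHn
    -- With the children's sums extended by zeros to `H`, each hypothesis has the node term and at
    -- most one child term, and the bound is proved termwise.
    refine le_trans ?_ (add_nonpos (add_nonpos hnode IHy) IHn)
    rw [← Finset.sum_add_distrib, ← Finset.sum_add_distrib]
    refine Finset.sum_le_sum fun i hi => ?_
    have hns : ¬ I.Satisfied i E := by
      rw [← f_eq_one_iff_satisfied]
      exact hH i hi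
    rw [DecisionTree.path, I.costUntil_cons_of_not_satisfied hns]
    by_cases hf : I.f i (insert e E) = 1
    · have hsat := (I.f_eq_one_iff_satisfied i _).mp hf
      simp only [hf, ne_eq, not_true_eq_false, and_false, if_false, add_zero,
        I.costUntil_of_satisfied hsat]
      exact mul_le_mul_of_nonneg_left (step_bound_of_covered hlam hc.le
        (I.gain_le_potential (hL e) hi (hH i hi)) hτ) (I.prob_nonneg i)
    · by_cases he : e ∈ I.pos i
      · simp only [he, hf, ne_eq, not_false_eq_true, and_self, not_true_eq_false, false_and,
          if_true, if_false, add_zero]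
        rw [← mul_add]
        refine mul_le_mul_of_nonneg_left (step_bound_of_survive hlam hc.le
          (I.costUntil_nonneg _ _ _) (I.gain_nonneg _ _ _ _) ?_ hτ) (I.prob_nonneg i)
        exact I.gain_add_potential_le (hL e) (by simp [hi, he, hf]) (Finset.filter_subset _ _)
          (fun j hj => by simp [he, (Finset.mem_filter.mp hj).2.1]) (hH i hi) hf
      · simp only [he, hf, ne_eq, not_false_eq_true, and_self, false_and,
          if_true, if_false, add_zero]
        rw [← mul_add]
        refine mul_le_mul_of_nonneg_left (step_bound_of_survive hlam hc.le
          (I.costUntil_nonneg _ _ _) (I.gain_nonneg _ _ _ _) ?_ hτ) (I.prob_nonneg i)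
        exact I.gain_add_potential_le (hL e) (by simp [hi, he, hf]) (Finset.filter_subset _ _)
          (fun j hj => by simpa [he] using (Finset.mem_filter.mp hj).2.1) (hH i hi) hf

/-! ### Feasibility of greedy trees and the approximation ratio -/

/-- The second alternative carries hypotheses that have been covered and dropped from `H` but still
walk down the tree. -/
lemma satisfied_of_isGreedyFrom (T : DecisionTree n) {E : Finset (Fin n)} {H : Finset (Fin m)}
    (hT : I.IsGreedyFrom T E H) {i : Fin m} (hi : i ∈ H ∨ I.Satisfied i E) :
    I.Satisfied i (E ∪ (T.path (I.pos i)).toFinset) := by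
  classical
  induction T generalizing E H with
  | leaf =>
    have hH : H = ∅ := hT
    simpa [hH, DecisionTree.path] using hi
  | node e yes no ihy ihn =>
    obtain ⟨-, -, -, hy, hn⟩ := hT
    have hins : ∀ l : List (Fin n), E ∪ (e :: l).toFinset = insert e E ∪ l.toFinset := by
      intro l; simp
    rw [DecisionTree.path, hins]
    by_cases hf : I.Satisfied i (insert e E)
    · split_ifs
      · exact ihy hy (Or.inr hf)
      · exact ihn hn (Or.inr hf)
    · have hiH : i ∈ H := hi.resolve_right fun h => hf (h.mono (Finset.subset_insert _ _))
      have hf' := (I.f_eq_one_iff_satisfied i (insert e E)).not.mpr hf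
      split_ifs with he
      · exact ihy hy (Or.inl (by simp [hiH, he, hf']))
      · exact ihn hn (Or.inl (by simp [hiH, he, hf']))

lemma filter_f_empty_ne_one [DecidablePred fun i => I.f i ∅ ≠ 1] :
    Finset.univ.filter (fun i => I.f i ∅ ≠ 1) = Finset.univ := by
  refine Finset.filter_true_of_mem fun i _ => ?_
  simp [f_empty]

lemma feasible_of_isGreedy {T : DecisionTree n} (hT : I.IsGreedy T) : I.Feasible T := by
  intro i
  rw [IsGreedy, filter_f_empty_ne_one] at hT
  simpa using I.satisfied_of_isGreedyFrom T hT (Or.inl (Finset.mem_univ i))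

/-- A hypothesis is always its own candidate, so its threshold is at least 1 and, by `thr_lt`, `m`
at least 2. Hence `log m` is bounded away from 0 and can absorb additive constants. -/
lemma two_le_card_hypotheses {m n : ℕ} (I : GeneralizedODT m n) : 2 ≤ m := by
  have hne : (Finset.univ : Finset (Fin m)).Nonempty := by
    rw [Finset.univ_nonempty_iff]
    by_contra h
    rw [not_nonempty_iff] at h
    have := I.prob_sum
    simp at this
  obtain ⟨i, -⟩ := hne
  have h1 : 1 ≤ I.thr i := le_trans (Finset.card_pos.mpr ⟨i, by simp⟩) (I.coverable i)
  have h2 := I.thr_lt i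
  omega

theorem expectedCost_le_of_isGreedy {T T' : DecisionTree n} (hT : I.IsGreedy T)
    (hT' : I.Feasible T') :
    I.expectedCost T ≤ 4 * (Real.logb 2 m + 1 + Real.log m) * I.expectedCost T' := by
  have hm : (1 : ℝ) ≤ m := by exact_mod_cast (by have := I.two_le_card_hypotheses; omega : 1 ≤ m)
  set M := Real.logb 2 m + 1 + Real.log m with hM
  have hM0 : 0 < M := by
    have h1 : 0 ≤ Real.logb 2 m := Real.logb_nonneg (by norm_num) hm
    have h2 := Real.log_nonneg hm
    linarith
  rw [IsGreedy, filter_f_empty_ne_one] at hT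
  have h := I.sum_cost_le_of_isGreedyFrom (by linarith : 0 < 2 * M) hT' T le_rfl hT (by simp)
    (by simp [f_empty])
  -- At the root every potential equals `M`. The choice `lam = 2 * M` leaves `lam - M = M` before
  -- the greedy cost and `lam ^ 2 = 4 * M * M` before the other.
  have h1 : ∑ i, I.prob i * (2 * M * I.costUntil i ∅ (T.path (I.pos i)) -
      (0 + I.costUntil i ∅ (T.path (I.pos i))) * I.potential i ∅ Finset.univ -
      2 * M * max (2 * M * I.costUntil i ∅ (T'.path (I.pos i)) - 0) 0) =
      M * I.expectedCost T - 4 * M * M * I.expectedCost T' := by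
    rw [expectedCost, expectedCost, Finset.mul_sum, Finset.mul_sum, ← Finset.sum_sub_distrib]
    refine Finset.sum_congr rfl fun i _ => ?_
    rw [max_eq_left (by
      have := mul_nonneg (by linarith : 0 ≤ 2 * M)
        (I.costUntil_nonneg i ∅ (T'.path (I.pos i)))
      linarith)]
    have : I.potential i ∅ Finset.univ = M := by simp [potential, f_empty, hM]
    rw [this]
    ring
  rw [h1] at h
  refine le_of_mul_le_mul_left ?_ hM0
  linarith

lemma logb_two_add_one_add_log_le {x : ℝ} (hx : 2 ≤ x) :
    Real.logb 2 x + 1 + Real.log x ≤ 5 * Real.log x := by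
  have h1 : (1 / 2 : ℝ) < Real.log 2 := by have := Real.log_two_gt_d9; linarith
  have h2 : Real.log 2 ≤ Real.log x := Real.log_le_log (by norm_num) hx
  have h3 : Real.logb 2 x ≤ 2 * Real.log x := by
    rw [Real.logb, div_le_iff₀ (by linarith)]
    nlinarith
  linarith

end GeneralizedODT

/-! ### Results and step counts of timed programs -/

namespace Timed

variable {α β : Type}

@[simp] lemma val_bind (x : Timed α) (g : α → Timed β) : (x >>= g).val = (g x.val).val := rfl

@[simp] lemma steps_bind (x : Timed α) (g : α → Timed β) :
    (x >>= g).steps = x.steps + (g x.val).steps := rfl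

@[simp] lemma val_op (a : α) : (op a).val = a := rfl

@[simp] lemma steps_op (a : α) : (op a).steps = 1 := rfl

lemma val_ite (c : Prop) [Decidable c] (x y : Timed α) :
    (if c then x else y).val = if c then x.val else y.val := by split_ifs <;> rfl

lemma steps_ite (c : Prop) [Decidable c] (x y : Timed α) :
    (if c then x else y).steps = if c then x.steps else y.steps := by split_ifs <;> rfl

@[simp] lemma val_loop_nil (body : β → α → Timed β) (b : β) : (loop body b []).val = b := rfl

@[simp] lemma val_loop_cons (body : β → α → Timed β) (b : β) (a : α) (l : List α) :
    (loop body b (a :: l)).val = (loop body (body b a).val l).val := rfl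

lemma steps_loop_cons (body : β → α → Timed β) (b : β) (a : α) (l : List α) :
    (loop body b (a :: l)).steps =
      (body b a).steps + (1 + (loop body (body b a).val l).steps) := rfl

lemma steps_loop_le {body : β → α → Timed β} {c : ℕ} (hc : ∀ b a, (body b a).steps ≤ c)
    (b : β) (l : List α) : (loop body b l).steps ≤ l.length * (c + 1) + 1 := by
  induction l generalizing b with
  | nil => simp [loop]
  | cons a l ih =>
    rw [steps_loop_cons, List.length_cons]
    have h1 := ih (body b a).val
    have h2 := hc b a
    linarith

lemma val_count (q : α → Timed Bool) (l : List α) :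
    (count q l).val = l.countP (fun a => (q a).val) := by
  have h : ∀ k : ℕ, (loop (fun k a => do
      let b ← q a
      if b then op (k + 1) else op k) k l).val = k + l.countP (fun a => (q a).val) := by
    induction l with
    | nil => simp
    | cons a l ih =>
      intro k
      rw [val_loop_cons, ih, List.countP_cons, val_bind, val_ite]
      split_ifs with hb
      · simp [add_assoc, add_comm]
      · simp
  simpa [count] using h 0

lemma steps_count_le {q : α → Timed Bool} {c : ℕ} (hc : ∀ a, (q a).steps ≤ c) (l : List α) :
    (count q l).steps ≤ l.length * (c + 2) + 1 := by
  refine steps_loop_le (c := c + 1) (fun k a => ?_) 0 l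
  have := hc a
  rw [steps_bind, steps_ite]
  simpa using this

/-- The accumulator grows at its head, hence the reversal. It is harmless later, where only the
underlying set, the length and the absence of duplicates matter. -/
lemma val_filter (q : α → Timed Bool) (l : List α) :
    (filter q l).val = (l.filter (fun a => (q a).val)).reverse := by
  have h : ∀ r : List α, (loop (fun r a => do
      let b ← q a
      if b then op (a :: r) else op r) r l).val =
      (l.filter (fun a => (q a).val)).reverse ++ r := by
    induction l with
    | nil => simp
    | cons a l ih =>
      intro r
      rw [val_loop_cons, ih, List.filter_cons, val_bind, val_ite]
      split_ifs <;> simp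
  simpa [filter] using h []

lemma steps_filter_le {q : α → Timed Bool} {c : ℕ} (hc : ∀ a, (q a).steps ≤ c) (l : List α) :
    (filter q l).steps ≤ l.length * (c + 2) + 1 := by
  refine steps_loop_le (c := c + 1) (fun r a => ?_) [] l
  have := hc a
  rw [steps_bind, steps_ite]
  simpa using this

lemma length_val_filter_le (q : α → Timed Bool) (l : List α) :
    (filter q l).val.length ≤ l.length := by
  rw [val_filter, List.length_reverse]
  exact List.length_filter_le _ _

lemma val_sum (g : α → Timed ℝ) (l : List α) :
    (sum g l).val = (l.map (fun a => (g a).val)).sum := by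
  have h : ∀ s : ℝ, (loop (fun s a => do
      let x ← g a
      op (s + x)) s l).val = s + (l.map (fun a => (g a).val)).sum := by
    induction l with
    | nil => simp
    | cons a l ih =>
      intro s
      rw [val_loop_cons, ih]
      simp [add_assoc]
  simpa [sum] using h 0

lemma steps_sum_le {g : α → Timed ℝ} {c : ℕ} (hc : ∀ a, (g a).steps ≤ c) (l : List α) :
    (sum g l).steps ≤ l.length * (c + 2) + 1 := by
  refine steps_loop_le (c := c + 1) (fun s a => ?_) 0 l
  have := hc a
  simpa using this

end Timed

namespace GeneralizedODT

variable {m n : ℕ} (I : GeneralizedODT m n)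

/-! ### Correctness of the implementation -/

lemma val_apartT (i j : Fin m) (E : List (Fin n)) :
    (I.apartT i j E).val = true ↔ j ∈ I.apartFrom i E.toFinset := by
  have h : ∀ r : Bool, (Timed.loop (fun r e => do
      let a ← Timed.op (decide (e ∈ I.pos i))
      let b ← Timed.op (decide (e ∈ I.pos j))
      let d ← Timed.op (a != b)
      Timed.op (r || d)) r E).val = true ↔
        r = true ∨ ∃ e ∈ E, ¬ (e ∈ I.pos i ↔ e ∈ I.pos j) := by
    induction E with
    | nil => simp
    | cons e E ih =>
      intro r
      rw [Timed.val_loop_cons, ih]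
      simp [or_assoc]
  rw [mem_apartFrom]
  simpa [apartT] using h false

lemma val_fT (i : Fin m) (E : List (Fin n)) : (I.fT i E).val = I.f i E.toFinset := by
  have hc : (List.finRange m).countP (fun j => (I.apartT i j E).val) =
      (I.apartFrom i E.toFinset).card := by
    rw [List.countP_eq_length_filter,
      ← List.toFinset_card_of_nodup ((List.nodup_finRange m).filter _)]
    congr 1
    ext j
    simp [val_apartT]
  simp only [fT, Timed.val_bind, Timed.val_op, Timed.val_count, hc]
  rw [f_def, mul_one_div]

lemma val_uncoveredT (i : Fin m) (E : List (Fin n)) :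
    (I.uncoveredT i E).val = true ↔ I.f i E.toFinset ≠ 1 := by
  simp [uncoveredT, val_fT]

/-- The minority part that the implementation uses. -/
def minority (H : Finset (Fin m)) (e : Fin n) : Finset (Fin m) :=
  if (H.filter (fun i => e ∈ I.pos i)).card ≤ (H.filter (fun i => e ∉ I.pos i)).card then
    H.filter (fun i => e ∈ I.pos i)
  else H.filter (fun i => e ∉ I.pos i)

lemma isMinority_minority (H : Finset (Fin m)) (e : Fin n) :
    I.IsMinority H e (I.minority H e) := by
  unfold minority
  split_ifs with h
  · exact Or.inl ⟨rfl, h⟩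
  · exact Or.inr ⟨rfl, by omega⟩

lemma toFinset_reverse_filter {α : Type} [DecidableEq α] (l : List α) (p : α → Prop)
    [DecidablePred p] :
    (l.filter (fun a => decide (p a))).reverse.toFinset = l.toFinset.filter p := by
  ext a
  simp

lemma val_scoreT (E : List (Fin n)) {H : List (Fin m)} (hH : H.Nodup) (e : Fin n) :
    (I.scoreT E H e).val = I.score E.toFinset H.toFinset (I.minority H.toFinset e) e := by
  have hy : (H.filter (fun i => decide (e ∈ I.pos i))).reverse.Nodup :=
    List.nodup_reverse.mpr (hH.filter _)
  have hz : (H.filter (fun i => decide (e ∉ I.pos i))).reverse.Nodup :=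
    List.nodup_reverse.mpr (hH.filter _)
  have cy := List.toFinset_card_of_nodup hy
  have cz := List.toFinset_card_of_nodup hz
  rw [toFinset_reverse_filter] at cy cz
  have sy := List.sum_toFinset I.prob hy
  have sz := List.sum_toFinset I.prob hz
  rw [toFinset_reverse_filter] at sy sz
  simp only [scoreT, Timed.val_bind, Timed.val_op, Timed.val_sum, Timed.val_count,
    Timed.val_filter, val_fT, List.countP_true, List.toFinset_cons, decide_eq_true_eq]
  rw [score, minority, cy, cz, ← List.sum_toFinset _ hH, one_div, mul_comm, ← div_eq_mul_inv]
  split_ifs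
  · rw [sy]
  · rw [sz]

/-- One round of the search for the best test. -/
noncomputable def pickStep (E : List (Fin n)) (H : List (Fin m)) (best : Option (Fin n × ℝ))
    (e : Fin n) : Timed (Option (Fin n × ℝ)) := do
  let s ← I.scoreT E H e
  match best with
  | none => Timed.op (some (e, s))
  | some (e', s') => do
      let b ← Timed.op (decide (s' < s))
      if b then Timed.op (some (e, s)) else Timed.op (some (e', s'))

lemma pickT_eq (E : List (Fin n)) (H : List (Fin m)) (R : List (Fin n)) :
    I.pickT E H R = Timed.loop (I.pickStep E H) none R := rfl

/-- The loop invariant is that the stored number is the score of the stored test; generalizing over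
that test lets the induction restart from whichever test wins a round. -/
lemma val_loop_pickStep (E : List (Fin n)) (H : List (Fin m)) (R : List (Fin n))
    (e₀ : Fin n) :
    ∃ e ∈ e₀ :: R, (Timed.loop (I.pickStep E H) (some (e₀, (I.scoreT E H e₀).val)) R).val =
      some (e, (I.scoreT E H e).val) ∧
      ∀ e' ∈ e₀ :: R, (I.scoreT E H e').val ≤ (I.scoreT E H e).val := by
  induction R generalizing e₀ with
  | nil => exact ⟨e₀, by simp⟩
  | cons e₁ R ih =>
    rw [Timed.val_loop_cons]
    by_cases h : (I.scoreT E H e₀).val < (I.scoreT E H e₁).val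
    · obtain ⟨e, he, hval, hmax⟩ := ih e₁
      refine ⟨e, List.mem_cons_of_mem _ he, ?_, ?_⟩
      · rw [← hval]
        simp [pickStep, h]
      · intro e' he'
        rcases List.mem_cons.mp he' with rfl | he'
        · exact h.le.trans (hmax e₁ (by simp))
        · exact hmax e' he'
    · obtain ⟨e, he, hval, hmax⟩ := ih e₀
      refine ⟨e, ?_, ?_, ?_⟩
      · simp only [List.mem_cons] at he ⊢
        tauto
      · rw [← hval]
        simp [pickStep, h]
      · intro e' he'
        simp only [List.mem_cons] at he'
        rcases he' with rfl | rfl | he'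
        · exact hmax _ (by simp)
        · exact (not_lt.mp h).trans (hmax e₀ (by simp))
        · exact hmax e' (by simp [he'])

lemma val_pickT (E : List (Fin n)) (H : List (Fin m)) {R : List (Fin n)} (hR : R ≠ []) :
    ∃ e ∈ R, (I.pickT E H R).val = some (e, (I.scoreT E H e).val) ∧
      ∀ e' ∈ R, (I.scoreT E H e').val ≤ (I.scoreT E H e).val := by
  cases R with
  | nil => exact absurd rfl hR
  | cons e₀ R => exact I.val_loop_pickStep E H R e₀

/-- The hypotheses in `H` that have the outcome described by `q` and are not yet covered. -/
noncomputable def branchT (E : List (Fin n)) (H : List (Fin m)) (q : Fin m → Bool) :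
    Timed (List (Fin m)) :=
  Timed.filter (fun i => do
    let a ← Timed.op (q i)
    let u ← I.uncoveredT i E
    Timed.op (a && u)) H

lemma val_branchT (E : List (Fin n)) (H : List (Fin m)) (q : Fin m → Bool) :
    (I.branchT E H q).val = (H.filter (fun i => q i && (I.uncoveredT i E).val)).reverse := by
  simp [branchT, Timed.val_filter]

lemma toFinset_val_branchT (E : List (Fin n)) (H : List (Fin m)) (q : Fin m → Prop)
    [DecidablePred q] [DecidablePred fun i => q i ∧ I.f i E.toFinset ≠ 1] :
    (I.branchT E H (fun i => decide (q i))).val.toFinset =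
      H.toFinset.filter (fun i => q i ∧ I.f i E.toFinset ≠ 1) := by
  ext i
  simp [val_branchT, val_uncoveredT]

lemma nodup_val_branchT (E : List (Fin n)) {H : List (Fin m)} (hH : H.Nodup)
    (q : Fin m → Bool) : (I.branchT E H q).val.Nodup := by
  rw [val_branchT]
  exact List.nodup_reverse.mpr (hH.filter _)

lemma val_buildT_nil (k : ℕ) (E R : List (Fin n)) : (I.buildT k E R []).val = .leaf := by
  cases k <;> simp [buildT]

lemma steps_buildT_nil_le (k : ℕ) (E R : List (Fin n)) : (I.buildT k E R []).steps ≤ 2 := by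
  cases k <;> simp [buildT]

lemma val_buildT_succ {E R : List (Fin n)} {H : List (Fin m)} {e : Fin n} {s : ℝ} (hH : H ≠ [])
    (he : (I.pickT E H R).val = some (e, s)) (k : ℕ) :
    (I.buildT (k + 1) E R H).val = .node e
      (I.buildT k (e :: E) (Timed.filter (fun e' => Timed.op (decide (e' ≠ e))) R).val
        (I.branchT (e :: E) H (fun i => decide (e ∈ I.pos i))).val).val
      (I.buildT k (e :: E) (Timed.filter (fun e' => Timed.op (decide (e' ≠ e))) R).val
        (I.branchT (e :: E) H (fun i => decide (e ∉ I.pos i))).val).val := by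
  have hb : H.isEmpty = false := by simpa using hH
  simp only [buildT, branchT, Timed.val_bind, Timed.val_op, he, hb, Bool.false_eq_true, if_false]

lemma steps_buildT_succ {E R : List (Fin n)} {H : List (Fin m)} {e : Fin n} {s : ℝ} (hH : H ≠ [])
    (he : (I.pickT E H R).val = some (e, s)) (k : ℕ) :
    (I.buildT (k + 1) E R H).steps = 1 + ((I.pickT E H R).steps +
      ((Timed.filter (fun e' => Timed.op (decide (e' ≠ e))) R).steps +
      ((I.branchT (e :: E) H (fun i => decide (e ∈ I.pos i))).steps +
      ((I.branchT (e :: E) H (fun i => decide (e ∉ I.pos i))).steps + (1 +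
      ((I.buildT k (e :: E) (Timed.filter (fun e' => Timed.op (decide (e' ≠ e))) R).val
        (I.branchT (e :: E) H (fun i => decide (e ∈ I.pos i))).val).steps +
      ((I.buildT k (e :: E) (Timed.filter (fun e' => Timed.op (decide (e' ≠ e))) R).val
        (I.branchT (e :: E) H (fun i => decide (e ∉ I.pos i))).val).steps + 1))))))) := by
  have hb : H.isEmpty = false := by simpa using hH
  simp only [buildT, branchT, Timed.val_op, Timed.steps_bind, Timed.steps_op, he, hb,
    Bool.false_eq_true, if_false]

/-- With no test left, `E` is everything and `f_univ` covers every hypothesis. Hence the search for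
a best test never fails on a nonempty `H`. -/
lemma ne_nil_of_uncovered {E R : List (Fin n)} {H : List (Fin m)} (hR : ∀ e, e ∈ R ↔ e ∉ E)
    (hH : ∀ i ∈ H, I.f i E.toFinset ≠ 1) (hH0 : H ≠ []) : R ≠ [] := by
  rintro rfl
  obtain ⟨i, hi⟩ := List.exists_mem_of_ne_nil H hH0
  refine hH i hi ?_
  have : E.toFinset = Finset.univ := by
    ext e
    simpa using hR e
  rw [this, f_univ]

/-- Each call removes its test from `R`, so a depth bound of `R.length` is never exhausted while
hypotheses remain. -/
theorem isGreedyFrom_buildT (k : ℕ) {E R : List (Fin n)} {H : List (Fin m)} (hnd : H.Nodup)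
    (hR : ∀ e, e ∈ R ↔ e ∉ E) (hk : R.length ≤ k) (hH : ∀ i ∈ H, I.f i E.toFinset ≠ 1) :
    I.IsGreedyFrom (I.buildT k E R H).val E.toFinset H.toFinset := by
  classical
  by_cases hH0 : H = []
  · subst hH0
    rw [val_buildT_nil]
    simp [IsGreedyFrom]
  have hR0 := I.ne_nil_of_uncovered hR hH hH0
  induction k generalizing E R H with
  | zero => exact absurd (List.length_eq_zero_iff.mp (by omega)) hR0
  | succ k ih =>
    obtain ⟨e, heR, he, hmax⟩ := I.val_pickT E H hR0
    have hbranch : ∀ q : Fin m → Prop, ∀ [DecidablePred q],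
        I.IsGreedyFrom (I.buildT k (e :: E)
          (Timed.filter (fun e' => Timed.op (decide (e' ≠ e))) R).val
          (I.branchT (e :: E) H (fun i => decide (q i))).val).val (insert e E.toFinset)
          (H.toFinset.filter (fun i => q i ∧ I.f i (insert e E.toFinset) ≠ 1)) := by
      intro q _
      have hH' : ∀ i ∈ (I.branchT (e :: E) H (fun i => decide (q i))).val,
          I.f i (e :: E).toFinset ≠ 1 := by
        intro i hi
        rw [← List.mem_toFinset, toFinset_val_branchT] at hi
        exact (Finset.mem_filter.mp hi).2.2
      have hR' : ∀ e', e' ∈ (Timed.filter (fun e' => Timed.op (decide (e' ≠ e))) R).val ↔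
          e' ∉ e :: E := by
        intro e'
        rw [Timed.val_filter]
        simp [hR, and_comm]
      have hlen : (Timed.filter (fun e' => Timed.op (decide (e' ≠ e))) R).val.length ≤ k := by
        have : (R.filter (fun e' => decide (e' ≠ e))).length < R.length :=
          List.length_filter_lt_length_iff_exists.mpr ⟨e, heR, by simp⟩
        rw [Timed.val_filter, List.length_reverse]
        simp only [Timed.val_op]
        omega
      have hnd' := I.nodup_val_branchT (e :: E) hnd (fun i => decide (q i))
      have hset := I.toFinset_val_branchT (e :: E) H q
      rw [List.toFinset_cons] at hset
      rw [← hset, ← List.toFinset_cons]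
      by_cases hnil : (I.branchT (e :: E) H (fun i => decide (q i))).val = []
      · rw [hnil, val_buildT_nil]
        simp [IsGreedyFrom]
      · exact ih hnd' hR' hlen hH' hnil (I.ne_nil_of_uncovered hR' hH' hnil)
    rw [I.val_buildT_succ hH0 he]
    refine ⟨by simpa [Finset.nonempty_iff_ne_empty] using hH0, by simpa using (hR e).mp heR,
      ⟨I.minority H.toFinset, fun e' => I.isMinority_minority _ e', fun e' he' => ?_⟩, ?_, ?_⟩
    · rw [← val_scoreT _ _ hnd, ← val_scoreT _ _ hnd]
      exact hmax e' ((hR e').mpr (by simpa using he'))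
    · convert hbranch (fun i => e ∈ I.pos i)
    · convert hbranch (fun i => e ∉ I.pos i)

theorem isGreedy_greedyT : I.IsGreedy I.greedyT.val := by
  have hval : (Timed.filter (fun i => I.uncoveredT i []) (List.finRange m)).val =
      (List.finRange m).reverse := by
    rw [Timed.val_filter, List.filter_eq_self.mpr]
    intro i _
    rw [val_uncoveredT]
    simp [f_empty]
  have h := I.isGreedyFrom_buildT n (E := []) (R := List.finRange n)
    (H := (List.finRange m).reverse) (List.nodup_reverse.mpr (List.nodup_finRange m))
    (by simp) (by simp) (by simp [f_empty])
  rw [IsGreedy, filter_f_empty_ne_one]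
  simp only [greedyT, Timed.val_bind, hval]
  have huniv : (List.finRange m).reverse.toFinset = Finset.univ := by
    ext i
    simp
  rwa [huniv, List.toFinset_nil] at h

/-! ### The number of steps -/

lemma steps_apartT_le (i j : Fin m) (E : List (Fin n)) :
    (I.apartT i j E).steps ≤ 5 * E.length + 1 := by
  have h := Timed.steps_loop_le (body := fun (r : Bool) e => do
      let a ← Timed.op (decide (e ∈ I.pos i))
      let b ← Timed.op (decide (e ∈ I.pos j))
      let d ← Timed.op (a != b)
      Timed.op (r || d)) (c := 4) (fun r e => by simp) false E
  rw [mul_comm]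
  exact h

lemma steps_fT_le {N : ℕ} (hN : 1 ≤ N) (hm : m ≤ N) (i : Fin m) {E : List (Fin n)}
    (hE : E.length ≤ N) : (I.fT i E).steps ≤ 13 * N ^ 2 := by
  have h1 := Timed.steps_count_le (q := fun j => I.apartT i j E) (c := 6 * N)
    (fun j => (I.steps_apartT_le i j E).trans (by omega)) (List.finRange m)
  rw [List.length_finRange] at h1
  have h2 : m * (6 * N + 2) ≤ N * (6 * N + 2) := Nat.mul_le_mul_right _ hm
  simp only [fT, Timed.steps_bind, Timed.steps_op]
  nlinarith

lemma steps_uncoveredT_le {N : ℕ} (hN : 1 ≤ N) (hm : m ≤ N) (i : Fin m) {E : List (Fin n)}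
    (hE : E.length ≤ N) : (I.uncoveredT i E).steps ≤ 14 * N ^ 2 := by
  have h1 := I.steps_fT_le hN hm i hE
  have h2 := Nat.one_le_pow 2 N hN
  simp only [uncoveredT, Timed.steps_bind, Timed.steps_op]
  omega

lemma steps_scoreT_le {N : ℕ} (hN : 1 ≤ N) (hm : m ≤ N) {E : List (Fin n)}
    (hE : E.length + 1 ≤ N) {H : List (Fin m)} (hH : H.length ≤ N) (e : Fin n) :
    (I.scoreT E H e).steps ≤ 80 * N ^ 3 := by
  have hf : ∀ q : Fin m → Bool, (Timed.filter (fun i => Timed.op (q i)) H).steps ≤ 4 * N := by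
    intro q
    have h1 := Timed.steps_filter_le (q := fun i => Timed.op (q i)) (c := 1) (fun _ => le_rfl) H
    omega
  have hl : ∀ q : Fin m → Bool, (Timed.filter (fun i => Timed.op (q i)) H).val.length ≤ N :=
    fun q => (Timed.length_val_filter_le _ H).trans hH
  have hc : ∀ l : List (Fin m), l.length ≤ N →
      (Timed.count (fun _ => Timed.op true) l).steps ≤ 4 * N := by
    intro l hl
    have h1 := Timed.steps_count_le (q := fun _ => Timed.op true) (c := 1) (fun _ => le_rfl) l
    omega
  have hs : ∀ l : List (Fin m), l.length ≤ N →
      (Timed.sum (fun i => Timed.op (I.prob i)) l).steps ≤ 4 * N := by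
    intro l hl
    have h1 := Timed.steps_sum_le (g := fun i => Timed.op (I.prob i)) (c := 1)
      (fun _ => le_rfl) l
    omega
  have hr : (Timed.sum (fun i => do
      let p ← Timed.op (I.prob i)
      let v ← I.fT i E
      let v' ← I.fT i (e :: E)
      let u ← Timed.op (v' - v)
      let w ← Timed.op (1 - v)
      let q ← Timed.op (u / w)
      Timed.op (p * q)) H).steps ≤ N * (26 * N ^ 2 + 7) + 1 := by
    refine (Timed.steps_sum_le (c := 26 * N ^ 2 + 5) (fun i => ?_) H).trans
      (Nat.add_le_add_right (Nat.mul_le_mul_right _ hH) 1)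
    have h1 := I.steps_fT_le hN hm i (by omega : E.length ≤ N)
    have h2 := I.steps_fT_le hN hm i (E := e :: E) (by simpa using hE)
    simp only [Timed.steps_bind, Timed.steps_op]
    omega
  have hN1 : 1 ≤ N ^ 3 := Nat.one_le_pow 3 N hN
  have hN2 : N ≤ N ^ 3 := Nat.le_self_pow (by norm_num) N
  have h1 := hf (fun i => decide (e ∈ I.pos i))
  have h2 := hf (fun i => decide (e ∉ I.pos i))
  have h3 := hc _ (hl (fun i => decide (e ∈ I.pos i)))
  have h4 := hc _ (hl (fun i => decide (e ∉ I.pos i)))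
  have h5 : ∀ b : Bool, (Timed.sum (fun i => Timed.op (I.prob i))
      (if b then (Timed.filter (fun i => Timed.op (decide (e ∈ I.pos i))) H).val
        else (Timed.filter (fun i => Timed.op (decide (e ∉ I.pos i))) H).val)).steps ≤
      4 * N := by
    intro b
    apply hs
    split_ifs
    · exact hl _
    · exact hl _
  have h6 : N * (26 * N ^ 2 + 7) + 1 = 26 * N ^ 3 + 7 * N + 1 := by ring
  rw [h6] at hr
  simp only [scoreT, Timed.steps_bind, Timed.steps_op, Timed.val_op]
  have h7 := h5 (decide ((Timed.count (fun _ => Timed.op true)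
    (Timed.filter (fun i => Timed.op (decide (e ∈ I.pos i))) H).val).val ≤
    (Timed.count (fun _ => Timed.op true)
      (Timed.filter (fun i => Timed.op (decide (e ∉ I.pos i))) H).val).val))
  linarith

lemma steps_pickT_le {N : ℕ} (hN : 1 ≤ N) (hm : m ≤ N) {E : List (Fin n)}
    (hE : E.length + 1 ≤ N) {H : List (Fin m)} (hH : H.length ≤ N) {R : List (Fin n)}
    (hR : R.length ≤ N) : (I.pickT E H R).steps ≤ 84 * N ^ 4 := by
  rw [pickT_eq]
  have h1 := Timed.steps_loop_le (body := I.pickStep E H) (c := 80 * N ^ 3 + 2)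
    (fun best e => by
      have h := I.steps_scoreT_le hN hm hE hH e
      rcases best with _ | ⟨e', s'⟩
      · simp only [pickStep, Timed.steps_bind, Timed.steps_op]
        omega
      · simp only [pickStep, Timed.steps_bind, Timed.steps_op, Timed.steps_ite, ite_self]
        omega) none R
  have h2 : R.length * (80 * N ^ 3 + 2 + 1) ≤ N * (80 * N ^ 3 + 2 + 1) :=
    Nat.mul_le_mul_right _ hR
  have h3 : N * (80 * N ^ 3 + 2 + 1) = 80 * N ^ 4 + 3 * N := by ring
  have hN1 : 1 ≤ N ^ 4 := Nat.one_le_pow 4 N hN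
  have hN2 : N ≤ N ^ 4 := Nat.le_self_pow (by norm_num) N
  omega

lemma steps_branchT_le {N : ℕ} (hN : 1 ≤ N) (hm : m ≤ N) {E : List (Fin n)}
    (hE : E.length ≤ N) {H : List (Fin m)} (hH : H.length ≤ N) (q : Fin m → Bool) :
    (I.branchT E H q).steps ≤ 19 * N ^ 4 := by
  have h1 := (Timed.steps_filter_le (q := fun i => do
    let a ← Timed.op (q i)
    let u ← I.uncoveredT i E
    Timed.op (a && u)) (c := 14 * N ^ 2 + 2) (fun i => by
      have h := I.steps_uncoveredT_le hN hm i hE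
      simp only [Timed.steps_bind, Timed.steps_op]
      omega) H).trans (Nat.add_le_add_right (Nat.mul_le_mul_right _ hH) 1)
  have h3 : N * (14 * N ^ 2 + 2 + 2) = 14 * N ^ 3 + 4 * N := by ring
  have hN1 : 1 ≤ N ^ 4 := Nat.one_le_pow 4 N hN
  have hN2 : N ≤ N ^ 4 := Nat.le_self_pow (by norm_num) N
  have hN3 : N ^ 3 ≤ N ^ 4 := Nat.pow_le_pow_right hN (by norm_num)
  rw [branchT]
  omega

lemma length_filter_add_length_filter_le {α : Type} (l : List α) {p q : α → Bool}
    (h : ∀ a, ¬ (p a = true ∧ q a = true)) :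
    (l.filter p).length + (l.filter q).length ≤ l.length := by
  induction l with
  | nil => simp
  | cons a l ih =>
    have := h a
    simp only [List.filter_cons]
    split_ifs <;> simp_all <;> omega

lemma length_val_branchT_add_le (E : List (Fin n)) (H : List (Fin m)) (e : Fin n) :
    (I.branchT E H (fun i => decide (e ∈ I.pos i))).val.length +
      (I.branchT E H (fun i => decide (e ∉ I.pos i))).val.length ≤ H.length := by
  rw [val_branchT, val_branchT, List.length_reverse, List.length_reverse]
  refine length_filter_add_length_filter_le H fun i => ?_
  simp only [Bool.and_eq_true, decide_eq_true_eq]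
  tauto

/-- The bound is linear in `H.length` because the two branch lists together are no longer than `H`;
this prevents exponential growth in the depth. The summand 2 pays for calls on an empty list. In
135, the search takes 84, the two branch lists 38 and the removal from `R` 4; the rest absorbs
constants. -/
lemma steps_buildT_le {N : ℕ} (hN : 1 ≤ N) (hm : m ≤ N) (k : ℕ) {E R : List (Fin n)}
    {H : List (Fin m)} (hE : E.length + k ≤ N) (hH : H.length ≤ N) (hR : R.length ≤ N) :
    (I.buildT k E R H).steps ≤ 2 + H.length * k * (135 * N ^ 4) := by
  induction k generalizing E R H with
  | zero => simp [buildT]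
  | succ k ih =>
    by_cases hH0 : H = []
    · subst hH0
      simpa using I.steps_buildT_nil_le (k + 1) E R
    have hN1 : 1 ≤ N ^ 4 := Nat.one_le_pow 4 N hN
    have hpick := I.steps_pickT_le hN hm (by omega : E.length + 1 ≤ N) hH hR
    have hHpos : 1 ≤ H.length := List.length_pos_iff.mpr hH0
    have hmul : 1 * (1 * (135 * N ^ 4)) ≤ H.length * ((k + 1) * (135 * N ^ 4)) :=
      Nat.mul_le_mul hHpos (Nat.mul_le_mul_right _ (by omega))
    rcases hbest : (I.pickT E H R).val with _ | ⟨e, s⟩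
    · have hb : H.isEmpty = false := by simpa using hH0
      simp only [buildT, Timed.steps_bind, Timed.steps_op, Timed.val_op, hbest, hb,
        Bool.false_eq_true, if_false]
      rw [mul_assoc]
      omega
    · have hE' : (e :: E).length + k ≤ N := by simp only [List.length_cons]; omega
      have hfil := (Timed.steps_filter_le (q := fun e' => Timed.op (decide (e' ≠ e))) (c := 1)
        (fun _ => le_rfl) R)
      have hR' := (Timed.length_val_filter_le (fun e' => Timed.op (decide (e' ≠ e))) R).trans hR
      have hlen := I.length_val_branchT_add_le (e :: E) H e
      have hby := I.steps_branchT_le hN hm (by omega : (e :: E).length ≤ N) hH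
        (fun i => decide (e ∈ I.pos i))
      have hbn := I.steps_branchT_le hN hm (by omega : (e :: E).length ≤ N) hH
        (fun i => decide (e ∉ I.pos i))
      have ihy := ih (H := (I.branchT (e :: E) H (fun i => decide (e ∈ I.pos i))).val)
        hE' (by omega) hR'
      have ihn := ih (H := (I.branchT (e :: E) H (fun i => decide (e ∉ I.pos i))).val)
        hE' (by omega) hR'
      have hN2 : N ≤ N ^ 4 := Nat.le_self_pow (by norm_num) N
      have hsum := Nat.mul_le_mul_right (k * (135 * N ^ 4)) hlen
      have hexp : H.length * (k + 1) * (135 * N ^ 4) =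
          H.length * (k * (135 * N ^ 4)) + H.length * (135 * N ^ 4) := by ring
      have hmul' := Nat.mul_le_mul_right (135 * N ^ 4) hHpos
      rw [add_mul] at hsum
      rw [mul_assoc] at ihy ihn
      rw [I.steps_buildT_succ hH0 hbest, hexp]
      omega

theorem steps_greedyT_le : I.greedyT.steps ≤ 160 * (m + n) ^ 6 := by
  have hN : 1 ≤ m + n := by
    have := I.two_le_card_hypotheses
    omega
  have hm : m ≤ m + n := by omega
  have hfil := Timed.steps_filter_le (q := fun i => I.uncoveredT i []) (c := 14 * (m + n) ^ 2)
    (fun i => I.steps_uncoveredT_le hN hm i (by simp)) (List.finRange m)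
  have hlen := Timed.length_val_filter_le (fun i => I.uncoveredT i []) (List.finRange m)
  rw [List.length_finRange] at hfil hlen
  have hbuild := I.steps_buildT_le hN hm n (E := []) (R := List.finRange n)
    (H := (Timed.filter (fun i => I.uncoveredT i []) (List.finRange m)).val)
    (by simp) (by omega) (by simp)
  have h1 : (Timed.filter (fun i => I.uncoveredT i []) (List.finRange m)).val.length * n *
      (135 * (m + n) ^ 4) ≤ (m + n) * (m + n) * (135 * (m + n) ^ 4) :=
    Nat.mul_le_mul_right _ (Nat.mul_le_mul (by omega) (by omega))
  have h2 : m * (14 * (m + n) ^ 2 + 2) ≤ (m + n) * (14 * (m + n) ^ 2 + 2) :=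
    Nat.mul_le_mul_right _ hm
  simp only [greedyT, Timed.steps_bind]
  generalize m + n = N at *
  have hN1 : 1 ≤ N ^ 6 := Nat.one_le_pow 6 N hN
  have hN2 : N ≤ N ^ 6 := Nat.le_self_pow (by norm_num) N
  have hN3 : N ^ 3 ≤ N ^ 6 := Nat.pow_le_pow_right hN (by norm_num)
  have h3 : N * N * (135 * N ^ 4) = 135 * N ^ 6 := by ring
  have h4 : N * (14 * N ^ 2 + 2) = 14 * N ^ 3 + 2 * N := by ring
  omega

end GeneralizedODT

theorem mainTheorem5 :
    ∃ (C : ℝ) (K d : ℕ), ∀ (m n : ℕ) (I : GeneralizedODT m n),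
      -- the functions `f i` are normalized, monotone and submodular with values in `[0, 1]`
      (∀ i, I.f i ∅ = 0 ∧ I.f i Finset.univ = 1 ∧ (∀ A, I.f i A ∈ Set.Icc (0 : ℝ) 1) ∧
        (∀ A B, A ⊆ B → I.f i A ≤ I.f i B) ∧
        (∀ A B, I.f i (A ∩ B) + I.f i (A ∪ B) ≤ I.f i A + I.f i B)) ∧
      -- covering `f i` means having at most `thr i` candidates
      (∀ i A, I.f i A = 1 ↔ (I.candidates i A).card ≤ I.thr i) ∧
      -- the greedy algorithm is feasible and loses at most a factor `O(log m)`
      (∀ T, I.IsGreedy T → I.Feasible T ∧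
        ∀ T', I.Feasible T' → I.expectedCost T ≤ C * Real.log m * I.expectedCost T') ∧
      -- it can be carried out in polynomially many steps
      (I.IsGreedy I.greedyT.val ∧ I.greedyT.steps ≤ K * (m + n) ^ d) := by
  -- The constant is 20 = 4 · 5: the ratio is `4 * M`, and `M ≤ 5 * log m` for `m ≥ 2`.
  refine ⟨20, 160, 6, fun m n I => ⟨fun i => ⟨I.f_empty i, I.f_univ i,
    fun A => ⟨I.f_nonneg i A, I.f_le_one i A⟩, fun A B => I.f_mono i, I.f_submodular i⟩,
    I.f_eq_one_iff, fun T hT => ⟨I.feasible_of_isGreedy hT, fun T' hT' => ?_⟩,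
    I.isGreedy_greedyT, I.steps_greedyT_le⟩⟩
  refine (I.expectedCost_le_of_isGreedy hT hT').trans ?_
  have hlog := GeneralizedODT.logb_two_add_one_add_log_le
    (by exact_mod_cast I.two_le_card_hypotheses : (2 : ℝ) ≤ m)
  refine mul_le_mul_of_nonneg_right (by linarith) ?_
  exact Finset.sum_nonneg fun i _ => mul_nonneg (I.prob_nonneg i) (I.costUntil_nonneg _ _ _)
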